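/- Let $\mathcal H_A=\mathcal H_B=\mathbb{C}^2$ with standard basis $|0\rangle,|1\rangle$; an operator is called real if its matrix elements in the standard basis are real. Let $\rho_{AB}$ be a real density operator on $\mathbb{C}^2\otimes\mathbb{C}^2$ (positive semidefinite, trace one, real), and put $\rho_B=\mathrm{Tr}_A\,\rho_{AB}$. For $\theta\in\mathbb{R}$ let $|\theta\rangle=\cos\frac{\theta}{2}|0\rangle+\sin\frac{\theta}{2}|1\rangle$ and let $$\tilde\rho_B(\theta)=\mathrm{Tr}_A\big[(|\theta\rangle\langle\theta|\otimes\mathbb{I})\,\rho_{AB}\big]$$ (the steering ellipse of $\rho_{AB}$). For a real Hermitian operator $\lambda=\frac12(n\mathbb{I}+r_1\sigma_1+r_3\sigma_3)$ on $\mathbb{C}^2$, where $\sigma_1=|0\rangle\langle1|+|1\rangle\langle0|$ and $\sigma_3=|0\rangle\langle0|-|1\rangle\langle1|$, let $\mathrm{Tilt}(\lambda)=\sqrt{r_1^2+r_3^2}/|n|$, with $\mathrm{Tilt}(\lambda)=\infty$ if $n=0$. The tilt of the steering ellipse is the tilt of any nonzero real Hermitian operator that is normal, with respect to $\langle X,Y\rangle=\mathrm{Tr}(X^\dagger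 Y)$, to the affine space spanned by $\{\tilde\rho_B(\theta)\mid\theta\in\mathbb{R}\}$ if this space is two-dimensional, and $\infty$ otherwise. For real Hermitian $X,Y$ with $Y$ invertible let $|X|_Y=Y^{-1}\,|YXY|\,Y^{-1}$, where $|Z|=\sqrt{Z^\dagger Z}$. Suppose that the steering ellipse of $\rho_{AB}$ has tilt $<1$. Then there is a positive definite real density operator $Y$ on $\mathbb{C}^2$ such that $$\int_0^{2\pi}\Big|\frac{d}{d\theta}\tilde\rho_B(\theta)\Big|_Y\,d\theta$$ is (well defined and) a scalar multiple of $\rho_B$. -/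

import Mathlib

open scoped ENNReal Kronecker ComplexOrder MatrixOrder Matrix.Norms.L2Operator

/-- A matrix on a finite-dimensional space with standard basis indexed by `ι` is real if all of its
matrix elements in the standard basis are real numbers. -/
def IsRealMatrix {ι : Type*} (M : Matrix ι ι ℂ) : Prop :=
  ∀ i j, (M i j).im = 0

/-- Real density operators: real, positive semidefinite, of trace one. -/
structure IsRealDensity {ι : Type*} [Fintype ι] (M : Matrix ι ι ℂ) : Prop where
  real : IsRealMatrix M
  posSemidef : M.PosSemidef
  trace_eq_one : M.trace = 1

/-- Positive definite real density operators. -/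
structure IsPosDefRealDensity {ι : Type*} [Fintype ι] (M : Matrix ι ι ℂ) : Prop where
  real : IsRealMatrix M
  posDef : M.PosDef
  trace_eq_one : M.trace = 1

/-- The partial trace over the first tensor factor. -/
def partialTraceA (M : Matrix (Fin 2 × Fin 2) (Fin 2 × Fin 2) ℂ) : Matrix (Fin 2) (Fin 2) ℂ :=
  Matrix.of fun i j => ∑ k, M (k, i) (k, j)

/-- The reduced operator `ρ_B = Tr_A ρ_AB`. -/
def reducedB (ρ : Matrix (Fin 2 × Fin 2) (Fin 2 × Fin 2) ℂ) : Matrix (Fin 2) (Fin 2) ℂ :=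
  partialTraceA ρ

/-- The vector `|θ⟩ = cos (θ/2) |0⟩ + sin (θ/2) |1⟩`. -/
noncomputable def ketTheta (θ : ℝ) : Fin 2 → ℂ :=
  ![(Real.cos (θ / 2) : ℂ), (Real.sin (θ / 2) : ℂ)]

/-- The projector `|θ⟩⟨θ|`. -/
noncomputable def projTheta (θ : ℝ) : Matrix (Fin 2) (Fin 2) ℂ :=
  Matrix.vecMulVec (ketTheta θ) (star (ketTheta θ))

/-- The steering ellipse of `ρ_AB` on `B`: `θ ↦ Tr_A ((|θ⟩⟨θ| ⊗ 𝕀) ρ_AB)`. -/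
noncomputable def steeringEllipse (ρ : Matrix (Fin 2 × Fin 2) (Fin 2 × Fin 2) ℂ) (θ : ℝ) :
    Matrix (Fin 2) (Fin 2) ℂ :=
  partialTraceA ((projTheta θ ⊗ₖ (1 : Matrix (Fin 2) (Fin 2) ℂ)) * ρ)

/-- The Pauli matrix `σ₁ = |0⟩⟨1| + |1⟩⟨0|`. -/
def pauliOne : Matrix (Fin 2) (Fin 2) ℂ := !![0, 1; 1, 0]

/-- The Pauli matrix `σ₃ = |0⟩⟨0| - |1⟩⟨1|`. -/
def pauliThree : Matrix (Fin 2) (Fin 2) ℂ := !![1, 0; 0, -1]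

/-- The coordinate `n` in `L = (n 𝕀 + r₁ σ₁ + r₃ σ₃) / 2`. -/
def coordN (L : Matrix (Fin 2) (Fin 2) ℂ) : ℝ := L.trace.re

/-- The coordinate `r₁` in `L = (n 𝕀 + r₁ σ₁ + r₃ σ₃) / 2`. -/
def coordOne (L : Matrix (Fin 2) (Fin 2) ℂ) : ℝ := (pauliOne * L).trace.re

/-- The coordinate `r₃` in `L = (n 𝕀 + r₁ σ₁ + r₃ σ₃) / 2`. -/
def coordThree (L : Matrix (Fin 2) (Fin 2) ℂ) : ℝ := (pauliThree * L).trace.re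

theorem coordN_eq (L : Matrix (Fin 2) (Fin 2) ℂ) : coordN L = (L 0 0).re + (L 1 1).re := by
  simp [coordN, Matrix.trace_fin_two]

theorem coordOne_eq (L : Matrix (Fin 2) (Fin 2) ℂ) : coordOne L = (L 0 1).re + (L 1 0).re := by
  simp [coordOne, pauliOne, Matrix.trace_fin_two, Matrix.vecMul, dotProduct, Fin.sum_univ_two]
  ring

theorem coordThree_eq (L : Matrix (Fin 2) (Fin 2) ℂ) :
    coordThree L = (L 0 0).re - (L 1 1).re := by
  simp [coordThree, pauliThree, Matrix.trace_fin_two, Matrix.vecMul, dotProduct, Fin.sum_univ_two]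
  ring

/-- Every real Hermitian `2 × 2` matrix is `(n 𝕀 + r₁ σ₁ + r₃ σ₃) / 2` for exactly one triple of
real numbers, the one given by `coordN`, `coordOne`, `coordThree`. -/
theorem eq_bloch_iff {L : Matrix (Fin 2) (Fin 2) ℂ} (hL : L.IsHermitian) (hr : IsRealMatrix L)
    (n r₁ r₃ : ℝ) :
    L = (1 / 2 : ℝ) • (n • (1 : Matrix (Fin 2) (Fin 2) ℂ) + r₁ • pauliOne + r₃ • pauliThree) ↔
      n = coordN L ∧ r₁ = coordOne L ∧ r₃ = coordThree L := by
  have h01 : (L 1 0).re = (L 0 1).re := by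
    have := congrArg Complex.re (hL.apply 0 1)
    simpa using this
  have i00 := hr 0 0
  have i01 := hr 0 1
  have i10 := hr 1 0
  have i11 := hr 1 1
  rw [coordN_eq, coordOne_eq, coordThree_eq]
  constructor
  · intro h
    have e00 := congrArg Complex.re (congrFun (congrFun h 0) 0)
    have e01 := congrArg Complex.re (congrFun (congrFun h 0) 1)
    have e11 := congrArg Complex.re (congrFun (congrFun h 1) 1)
    simp [pauliOne, pauliThree] at e00 e01 e11
    refine ⟨?_, ?_, ?_⟩ <;> linarith
  · rintro ⟨rfl, rfl, rfl⟩
    ext i j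
    fin_cases i <;> fin_cases j <;> apply Complex.ext <;>
      simp [pauliOne, pauliThree, i00, i01, i10, i11, h01] <;> ring

/-- The tilt `√(r₁² + r₃²) / |n|` of a real Hermitian operator, equal to `∞` if `n = 0`. -/
noncomputable def tilt (L : Matrix (Fin 2) (Fin 2) ℂ) : ℝ≥0∞ :=
  if coordN L = 0 then ∞
  else ENNReal.ofReal (√(coordOne L ^ 2 + coordThree L ^ 2) / |coordN L|)

/-- The direction of the real affine space spanned by the steering ellipse. -/
noncomputable def steeringDirection (ρ : Matrix (Fin 2 × Fin 2) (Fin 2 × Fin 2) ℂ) :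
    Submodule ℝ (Matrix (Fin 2) (Fin 2) ℂ) :=
  (affineSpan ℝ (Set.range (steeringEllipse ρ))).direction

/-- `H` is a nonzero real Hermitian operator that is normal, for the inner product
`⟨X, Y⟩ = Tr (X† Y)`, to the affine space spanned by the steering ellipse. -/
structure IsSteeringNormal (ρ : Matrix (Fin 2 × Fin 2) (Fin 2 × Fin 2) ℂ)
    (H : Matrix (Fin 2) (Fin 2) ℂ) : Prop where
  isHermitian : H.IsHermitian
  real : IsRealMatrix H
  ne_zero : H ≠ 0
  normal : ∀ V ∈ steeringDirection ρ, (H.conjTranspose * V).trace = 0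

open Classical in
/-- The tilt of the steering ellipse: if the ellipse spans a two-dimensional affine space, the
common value of the tilts of its nonzero normal vectors (they all agree, see
`steeringTilt_eq_tilt`, so that the infimum is that value); otherwise `∞`. -/
noncomputable def steeringTilt (ρ : Matrix (Fin 2 × Fin 2) (Fin 2 × Fin 2) ℂ) : ℝ≥0∞ :=
  if Module.finrank ℝ (steeringDirection ρ) = 2 then
    ⨅ (H : Matrix (Fin 2) (Fin 2) ℂ) (_ : IsSteeringNormal ρ H), tilt H
  else ∞

theorem projTheta_apply (θ : ℝ) (k l : Fin 2) :
    projTheta θ k l =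
      ((![Real.cos (θ / 2), Real.sin (θ / 2)] k * ![Real.cos (θ / 2), Real.sin (θ / 2)] l : ℝ) :
        ℂ) := by
  have h : ketTheta θ = fun k => ((![Real.cos (θ / 2), Real.sin (θ / 2)] k : ℝ) : ℂ) := by
    funext k
    fin_cases k <;> simp [ketTheta]
  rw [projTheta, Matrix.vecMulVec_apply, h]
  simp only [Pi.star_apply, Complex.star_def, Complex.conj_ofReal, Complex.ofReal_mul]

theorem steeringEllipse_apply (ρ : Matrix (Fin 2 × Fin 2) (Fin 2 × Fin 2) ℂ) (θ : ℝ)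
    (i j : Fin 2) :
    steeringEllipse ρ θ i j = ∑ k, ∑ l,
      ((![Real.cos (θ / 2), Real.sin (θ / 2)] k * ![Real.cos (θ / 2), Real.sin (θ / 2)] l : ℝ) :
        ℂ) * ρ (l, i) (k, j) := by
  simp only [steeringEllipse, partialTraceA, Matrix.of_apply, Matrix.mul_apply,
    Fintype.sum_prod_type, Matrix.kronecker_apply, projTheta_apply, Matrix.one_apply, mul_ite,
    mul_one, mul_zero, ite_mul, zero_mul, Finset.sum_ite_eq, Finset.mem_univ, if_true]

/-- The steering ellipse of a real state consists of real Hermitian operators. -/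
theorem steeringEllipse_real {ρ : Matrix (Fin 2 × Fin 2) (Fin 2 × Fin 2) ℂ} (hρ : IsRealDensity ρ)
    (θ : ℝ) : (steeringEllipse ρ θ).IsHermitian ∧ IsRealMatrix (steeringEllipse ρ θ) := by
  constructor
  · ext i j
    rw [Matrix.conjTranspose_apply, steeringEllipse_apply, steeringEllipse_apply, star_sum,
      Finset.sum_comm]
    refine Finset.sum_congr rfl fun k _ => ?_
    rw [star_sum]
    refine Finset.sum_congr rfl fun l _ => ?_
    rw [star_mul', hρ.posSemidef.isHermitian.apply, Complex.star_def, Complex.conj_ofReal,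
      mul_comm (![Real.cos (θ / 2), Real.sin (θ / 2)] k)]
  · intro i j
    rw [steeringEllipse_apply, Complex.im_sum]
    refine Finset.sum_eq_zero fun k _ => ?_
    rw [Complex.im_sum]
    refine Finset.sum_eq_zero fun l _ => ?_
    rw [Complex.im_ofReal_mul, hρ.real, mul_zero]

/-- The steering ellipse is a smooth curve, so its derivative is the usual one. -/
theorem differentiable_steeringEllipse (ρ : Matrix (Fin 2 × Fin 2) (Fin 2 × Fin 2) ℂ) :
    Differentiable ℝ (steeringEllipse ρ) := by
  rw [show steeringEllipse ρ = fun θ i j => steeringEllipse ρ θ i j from rfl]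
  refine differentiable_pi.2 fun i => differentiable_pi.2 fun j => ?_
  simp only [steeringEllipse_apply, Fin.sum_univ_two, Matrix.cons_val_zero, Matrix.cons_val_one]
  fun_prop

/-- All nonzero normals of a non-degenerate steering ellipse have the same tilt. -/
theorem tilt_eq_of_isSteeringNormal {ρ : Matrix (Fin 2 × Fin 2) (Fin 2 × Fin 2) ℂ}
    (hρ : IsRealDensity ρ) (h2 : Module.finrank ℝ (steeringDirection ρ) = 2)
    {H K : Matrix (Fin 2) (Fin 2) ℂ} (hH : IsSteeringNormal ρ H) (hK : IsSteeringNormal ρ K) :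
    tilt H = tilt K := by
  let S : Submodule ℝ (Matrix (Fin 2) (Fin 2) ℂ) :=
    { carrier := {M | M.IsHermitian ∧ IsRealMatrix M}
      add_mem' := fun {a b} ha hb => ⟨ha.1.add hb.1, fun i j => by
        simp [ha.2 i j, hb.2 i j]⟩
      zero_mem' := ⟨Matrix.isHermitian_zero, fun i j => by simp⟩
      smul_mem' := fun c a ha => ⟨by
        rw [Matrix.IsHermitian, Matrix.conjTranspose_smul, ha.1.eq, star_trivial], fun i j => by
        simp [ha.2 i j]⟩ }
  have hWS : steeringDirection ρ ≤ S := by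
    rw [steeringDirection, direction_affineSpan, vectorSpan_def, Submodule.span_le]
    rintro _ ⟨_, ⟨s, rfl⟩, _, ⟨t, rfl⟩, rfl⟩
    exact S.sub_mem (steeringEllipse_real hρ s) (steeringEllipse_real hρ t)
  let φ : Matrix (Fin 2) (Fin 2) ℂ →ₗ[ℝ] EuclideanSpace ℝ (Fin 3) :=
    { toFun := fun L => !₂[coordN L, coordOne L, coordThree L]
      map_add' := fun a b => by
        ext i
        fin_cases i <;> simp [coordN_eq, coordOne_eq, coordThree_eq] <;> ring
      map_smul' := fun c a => by
        ext i
        fin_cases i <;> simp [coordN_eq, coordOne_eq, coordThree_eq] <;> ring }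
  have hφ0 : ∀ L, φ L 0 = coordN L := fun L => rfl
  have hφ1 : ∀ L, φ L 1 = coordOne L := fun L => rfl
  have hφ2 : ∀ L, φ L 2 = coordThree L := fun L => rfl
  have hinj : ∀ L ∈ S, φ L = 0 → L = 0 := by
    rintro L ⟨h1, h3⟩ h0
    rw [(eq_bloch_iff h1 h3 _ _ _).2 ⟨rfl, rfl, rfl⟩, ← hφ0, ← hφ1, ← hφ2, h0]
    simp
  let W : Submodule ℝ (EuclideanSpace ℝ (Fin 3)) := (steeringDirection ρ).map φ
  have hW : Module.finrank ℝ W = 2 := by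
    rw [← h2]
    have hi : Function.Injective (φ.domRestrict (steeringDirection ρ)) := by
      rw [← LinearMap.ker_eq_bot, LinearMap.ker_eq_bot']
      intro m hm
      exact Subtype.ext (hinj m (hWS m.2) hm)
    have := LinearMap.finrank_range_of_inj hi
    rwa [LinearMap.range_domRestrict] at this
  have hperp : Module.finrank ℝ Wᗮ = 1 := by
    have := W.finrank_add_finrank_orthogonal
    rw [hW, finrank_euclideanSpace_fin] at this
    omega
  have hmem : ∀ M, IsSteeringNormal ρ M → φ M ∈ Wᗮ := by
    intro M hM
    rw [Submodule.mem_orthogonal]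
    rintro _ ⟨V, hV, rfl⟩
    have h0 := congrArg Complex.re (hM.normal V hV)
    have hVS := hWS hV
    have a1 : (V 1 0).re = (V 0 1).re := by
      have := congrArg Complex.re (hVS.1.apply 0 1)
      simpa using this
    have a2 : (M 1 0).re = (M 0 1).re := by
      have := congrArg Complex.re (hM.isHermitian.apply 0 1)
      simpa using this
    rw [hM.isHermitian.eq] at h0
    simp only [Matrix.trace_fin_two, Matrix.mul_apply, Fin.sum_univ_two, Complex.add_re,
      Complex.mul_re, hM.real _ _, zero_mul, sub_zero, Complex.zero_re] at h0
    rw [PiLp.inner_apply, Fin.sum_univ_three, hφ0, hφ1, hφ2, hφ0, hφ1, hφ2]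
    simp only [coordN_eq, coordOne_eq, coordThree_eq, RCLike.inner_apply,
      conj_trivial]
    rw [a1, a2] at *
    linarith
  have hne : (⟨φ H, hmem H hH⟩ : Wᗮ) ≠ 0 := fun h =>
    hH.ne_zero (hinj H ⟨hH.isHermitian, hH.real⟩ (congrArg Subtype.val h))
  obtain ⟨c, hc⟩ := (finrank_eq_one_iff_of_nonzero' _ hne).1 hperp ⟨φ K, hmem K hK⟩
  have hc' : c • φ H = φ K := congrArg Subtype.val hc
  have hc0 : c ≠ 0 := by
    rintro rfl
    exact hK.ne_zero (hinj K ⟨hK.isHermitian, hK.real⟩ (by rw [← hc', zero_smul]))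
  have k0 : coordN K = c * coordN H := by rw [← hφ0, ← hc', ← hφ0]; rfl
  have k1 : coordOne K = c * coordOne H := by rw [← hφ1, ← hc', ← hφ1]; rfl
  have k2 : coordThree K = c * coordThree H := by rw [← hφ2, ← hc', ← hφ2]; rfl
  have hs : (c * coordOne H) ^ 2 + (c * coordThree H) ^ 2 =
      |c| ^ 2 * (coordOne H ^ 2 + coordThree H ^ 2) := by
    rw [sq_abs]; ring
  rw [tilt, tilt, k0, k1, k2, hs, Real.sqrt_mul (sq_nonneg _), Real.sqrt_sq (abs_nonneg c),
    abs_mul, mul_div_mul_left _ _ (abs_ne_zero.2 hc0)]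
  simp [hc0]

theorem steeringTilt_eq_tilt {ρ : Matrix (Fin 2 × Fin 2) (Fin 2 × Fin 2) ℂ}
    (hρ : IsRealDensity ρ) (h2 : Module.finrank ℝ (steeringDirection ρ) = 2)
    {H : Matrix (Fin 2) (Fin 2) ℂ} (hH : IsSteeringNormal ρ H) : steeringTilt ρ = tilt H := by
  rw [steeringTilt, if_pos h2]
  refine le_antisymm (iInf₂_le H hH) (le_iInf₂ fun K hK => ?_)
  exact (tilt_eq_of_isSteeringNormal hρ h2 hH hK).le

/-- The absolute value `|X|_Y = Y⁻¹ |Y X Y| Y⁻¹`, where `|Z| = √(Z† Z)`. -/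
noncomputable def absRel (Y X : Matrix (Fin 2) (Fin 2) ℂ) : Matrix (Fin 2) (Fin 2) ℂ :=
  Y⁻¹ * CFC.abs (Y * X * Y) * Y⁻¹

/-!
For `M ≥ 0` put `F(M) = ∫ tr |√M X_θ √M| dθ`, where `X_θ` is the derivative of the steering ellipse.
A tilt smaller than one forces `det X_θ < 0`: the `X_θ` are orthogonal to a definite matrix. Hence
`|X_θ|_Y` is a supergradient of `M ↦ tr |√M X_θ √M|` at `M = Y²`, and if `F` attains its maximum on
the compact set `{M ≥ 0, tr (M ρ_B) = 1}` at a positive definite `M`, the first-order condition says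
precisely that `∫ |X_θ|_{√M} dθ` is a multiple of `ρ_B`.

A singular `M` cannot be a maximiser. There the integrand of `F` is `|tr (M X_θ)|`, which vanishes
for some `θ₀` because `X_{θ + π} = -X_θ`. The rate at which `F` grows when `M` is moved towards the
identity is at least of the order of `∫ dθ / |tr (M X_θ)|`, which diverges like `∫ dθ / |θ - θ₀|`.
-/

open Matrix MeasureTheory Filter Topology

section PosDef

variable {𝕜 n : Type*} [RCLike 𝕜] [Fintype n] {A B : Matrix n n 𝕜}

theorem trace_mul_nonneg_of_posSemidef (hA : A.PosSemidef) (hB : B.PosSemidef) :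
    0 ≤ (A * B).trace := by
  classical
  obtain ⟨C, rfl⟩ := CStarAlgebra.nonneg_iff_eq_star_mul_self.1 hB.nonneg
  rw [star_eq_conjTranspose, ← mul_assoc, trace_mul_comm, ← mul_assoc]
  exact (hA.mul_mul_conjTranspose_same C).trace_nonneg

theorem trace_mul_pos_of_posDef (hA : A.PosSemidef) (hA₀ : A ≠ 0) (hB : B.PosDef) :
    0 < (A * B).trace := by
  classical
  refine (trace_mul_nonneg_of_posSemidef hA hB.posSemidef).lt_of_ne' fun h => hA₀ ?_
  obtain ⟨C, rfl⟩ := CStarAlgebra.nonneg_iff_eq_star_mul_self.1 hB.posSemidef.nonneg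
  rw [star_eq_conjTranspose] at h hB
  obtain ⟨hC', hC⟩ : IsUnit Cᴴ ∧ IsUnit C := by
    simpa only [isUnit_iff_isUnit_det, det_mul, IsUnit.mul_iff] using hB.isUnit
  rw [← mul_assoc, trace_mul_comm, ← mul_assoc,
    (hA.mul_mul_conjTranspose_same C).trace_eq_zero_iff] at h
  rwa [hC'.mul_left_eq_zero, hC.mul_right_eq_zero] at h

theorem posSemidef_adjugate_of_posDef [DecidableEq n] (hA : A.PosDef) : A.adjugate.PosSemidef := by
  have h : A.adjugate = A.det • A⁻¹ := by
    rw [inv_def, smul_smul, Ring.mul_inverse_cancel _ ((isUnit_iff_isUnit_det _).1 hA.isUnit),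
      one_smul]
  rw [h]
  exact hA.inv.posSemidef.smul hA.det_pos.le

end PosDef

theorem isClosed_setOf_posSemidef {𝕜 n : Type*} [RCLike 𝕜] [Finite n] :
    IsClosed {M : Matrix n n 𝕜 | M.PosSemidef} := by
  have := Fintype.ofFinite n
  simp only [posSemidef_iff_dotProduct_mulVec, IsHermitian, Set.ofPred_and, Set.ofPred_forall]
  refine (isClosed_eq (by fun_prop) continuous_id).inter (isClosed_iInter fun x => ?_)
  exact isClosed_le continuous_const (by fun_prop)

theorem posDef_of_apply_zero_pos_of_det_pos {M : Matrix (Fin 2) (Fin 2) ℝ} (hM : M.IsSymm)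
    (h₀ : 0 < M 0 0) (hdet : 0 < M.det) : M.PosDef := by
  refine .of_dotProduct_mulVec_pos (by simpa using hM) fun x hx => ?_
  have hsymm := hM.apply 0 1
  have hsq : M 0 0 * (star x ⬝ᵥ M *ᵥ x) = (M 0 0 * x 0 + M 0 1 * x 1) ^ 2 + M.det * x 1 ^ 2 := by
    simp only [dotProduct, Pi.star_apply, star_trivial, mulVec, Fin.sum_univ_two, det_fin_two,
      hsymm]
    ring
  refine pos_of_mul_pos_right (hsq ▸ ?_) h₀.le
  rcases eq_or_ne (x 1) 0 with h₁ | h₁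
  · have : x 0 ≠ 0 := fun h => hx (by ext i; fin_cases i <;> assumption)
    simp only [h₁, mul_zero, add_zero, ne_eq, OfNat.ofNat_ne_zero, not_false_eq_true, zero_pow]
    positivity
  · positivity

theorem eventually_posDef_add_smul {M V : Matrix (Fin 2) (Fin 2) ℝ} (hM : M.PosDef)
    (hV : V.IsSymm) : ∀ᶠ ε in 𝓝 (0 : ℝ), (M + ε • V).PosDef := by
  have hline : Continuous fun ε : ℝ => M + ε • V := by fun_prop
  filter_upwards
    [((hline.matrix_elem 0 0).tendsto 0).eventually_const_lt (by simpa using hM.diag_pos),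
      (hline.matrix_det.tendsto 0).eventually_const_lt (by simpa using hM.det_pos)] with ε h₀ hdet
  exact posDef_of_apply_zero_pos_of_det_pos
    ((isHermitian_iff_isSymm.1 hM.isHermitian).add (hV.smul ε)) h₀ hdet

section TwoByTwo

variable {R : Type*} [CommRing R]

theorem mul_mul_eq_trace_smul_sub_det_smul_adjugate (N X : Matrix (Fin 2) (Fin 2) R) :
    X * N * X = (N * X).trace • X - X.det • N.adjugate := by
  rw [← etaExpand_eq X, ← etaExpand_eq N]
  ext i j
  fin_cases i <;> fin_cases j <;>
    simp [adjugate_fin_two, det_fin_two, trace_fin_two, Matrix.mul_apply] <;> ring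

theorem sub_det_smul_adjugate_mul_mul_self (N X : Matrix (Fin 2) (Fin 2) R) :
    (X * N * X - X.det • N.adjugate) * N * (X * N * X - X.det • N.adjugate) =
      ((N * X).trace ^ 2 - 4 * (N.det * X.det)) • (X * N * X) := by
  have h := mul_mul_eq_trace_smul_sub_det_smul_adjugate N X
  simp only [h, sub_mul, mul_sub, smul_mul_assoc, mul_smul_comm, adjugate_mul, mul_adjugate,
    mul_assoc X N N.adjugate, mul_one, one_mul, smul_sub]
  module

theorem trace_mul_sub_det_smul_adjugate_self (N X : Matrix (Fin 2) (Fin 2) R) :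
    (N * (X * N * X - X.det • N.adjugate)).trace = (N * X).trace ^ 2 - 4 * (N.det * X.det) := by
  rw [mul_mul_eq_trace_smul_sub_det_smul_adjugate]
  simp only [mul_sub, mul_smul_comm, mul_adjugate, trace_sub, trace_smul, trace_one, smul_eq_mul,
    Fintype.card_fin, Nat.cast_ofNat]
  ring

theorem discrim_mul_discrim_eq {M N X : Matrix (Fin 2) (Fin 2) R} (hM : M.IsSymm) (hN : N.IsSymm)
    (hX : X.IsSymm) :
    ((M * X).trace ^ 2 - 4 * (M.det * X.det)) * ((N * X).trace ^ 2 - 4 * (N.det * X.det)) =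
      (M * (X * N * X - X.det • N.adjugate)).trace ^ 2 +
        4 * X.det * ((M * X * N) 0 1 - (M * X * N) 1 0) ^ 2 := by
  simp only [adjugate_fin_two, det_fin_two, trace_fin_two, mul_apply, Fin.sum_univ_two,
    Matrix.sub_apply, Matrix.smul_apply, smul_eq_mul, of_apply, cons_val', cons_val_zero,
    cons_val_one, cons_val_fin_one, hM.apply 0 1, hN.apply 0 1, hX.apply 0 1]
  ring

end TwoByTwo

/-- The difference of the two eigenvalues of `M X`, i.e. the square root of the discriminant of its
characteristic polynomial. For `M ≥ 0` and symmetric `X` with `det X ≤ 0` it is the trace norm of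
`√M X √M`. -/
noncomputable def eigengap (M X : Matrix (Fin 2) (Fin 2) ℝ) : ℝ :=
  √((M * X).trace ^ 2 - 4 * (M.det * X.det))

/-- The operator `|X|_Y` in terms of `N = Y²`, for symmetric `X` with `det X < 0`: by
Cayley–Hamilton, `|Z| = (Z² - det Z) / (λ - μ)` when `Z = Y X Y` has eigenvalues `μ < 0 < λ`. -/
noncomputable def relAbs (N X : Matrix (Fin 2) (Fin 2) ℝ) : Matrix (Fin 2) (Fin 2) ℝ :=
  (eigengap N X)⁻¹ • (X * N * X - X.det • N.adjugate)

section RelAbs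

variable {M N X : Matrix (Fin 2) (Fin 2) ℝ}

theorem eigengap_nonneg : 0 ≤ eigengap M X :=
  Real.sqrt_nonneg _

theorem continuous_eigengap {T : Type*} [TopologicalSpace T]
    {f g : T → Matrix (Fin 2) (Fin 2) ℝ} (hf : Continuous f) (hg : Continuous g) :
    Continuous fun t => eigengap (f t) (g t) := by
  unfold eigengap
  fun_prop

theorem eigengap_sq (hM : 0 ≤ M.det) (hX : X.det ≤ 0) :
    eigengap M X ^ 2 = (M * X).trace ^ 2 - 4 * (M.det * X.det) :=
  Real.sq_sqrt (by nlinarith [sq_nonneg (M * X).trace, mul_nonneg hM (neg_nonneg.2 hX)])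

theorem eigengap_pos (hM : 0 < M.det) (hX : X.det < 0) : 0 < eigengap M X :=
  Real.sqrt_pos.2 (by nlinarith [sq_nonneg (M * X).trace, mul_pos hM (neg_pos.2 hX)])

theorem eigengap_of_det_eq_zero (hM : M.det = 0) : eigengap M X = |(M * X).trace| := by
  rw [eigengap, hM, zero_mul, mul_zero, sub_zero, Real.sqrt_sq_eq_abs]

theorem eigengap_smul {c : ℝ} (hc : 0 ≤ c) : eigengap (c • M) X = c * eigengap M X := by
  have h : ((c • M) * X).trace ^ 2 - 4 * ((c • M).det * X.det) =
      c ^ 2 * ((M * X).trace ^ 2 - 4 * (M.det * X.det)) := by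
    rw [smul_mul_assoc, trace_smul, det_smul, Fintype.card_fin, smul_eq_mul]
    ring
  rw [eigengap, eigengap, h, Real.sqrt_mul (sq_nonneg c), Real.sqrt_sq hc]

theorem relAbs_smul {c : ℝ} (hc : 0 < c) : relAbs (c • N) X = relAbs N X := by
  have h : X * (c • N) * X - X.det • (c • N).adjugate = c • (X * N * X - X.det • N.adjugate) := by
    simp [adjugate_smul, smul_sub, smul_comm c]
  rw [relAbs, relAbs, h, eigengap_smul hc.le, smul_smul, mul_inv, mul_right_comm,
    inv_mul_cancel₀ hc.ne', one_mul]

theorem trace_mul_relAbs_self (hN : 0 < N.det) (hX : X.det < 0) :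
    (N * relAbs N X).trace = eigengap N X := by
  rw [relAbs, mul_smul_comm, trace_smul, trace_mul_sub_det_smul_adjugate_self,
    ← eigengap_sq hN.le hX.le, smul_eq_mul, sq, inv_mul_cancel_left₀ (eigengap_pos hN hX).ne']

theorem relAbs_mul_mul_relAbs (hN : 0 < N.det) (hX : X.det < 0) :
    relAbs N X * N * relAbs N X = X * N * X := by
  have hgap := (eigengap_pos hN hX).ne'
  rw [relAbs, smul_mul_assoc, smul_mul_assoc, mul_smul_comm, sub_det_smul_adjugate_mul_mul_self,
    ← eigengap_sq hN.le hX.le, smul_smul, smul_smul, sq, ← mul_inv, inv_mul_cancel₀ (by positivity),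
    one_smul]

theorem posSemidef_sub_det_smul_adjugate (hN : N.PosDef) (hX : X.IsSymm) (hd : X.det ≤ 0) :
    (X * N * X - X.det • N.adjugate).PosSemidef := by
  have h := hN.posSemidef.conjTranspose_mul_mul_same X
  rw [conjTranspose_eq_transpose_of_trivial, hX] at h
  rw [sub_eq_add_neg, ← neg_smul]
  exact h.add ((posSemidef_adjugate_of_posDef hN).smul (neg_nonneg.2 hd))

theorem posSemidef_relAbs (hN : N.PosDef) (hX : X.IsSymm) (hd : X.det ≤ 0) :
    (relAbs N X).PosSemidef :=
  (posSemidef_sub_det_smul_adjugate hN hX hd).smul (inv_nonneg.2 eigengap_nonneg)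

-- `relAbs N X` is a supergradient of the concave function `M ↦ eigengap M X` at `N`.
theorem eigengap_le_trace_mul_relAbs (hM : M.PosSemidef) (hN : N.PosDef) (hX : X.IsSymm)
    (hd : X.det < 0) : eigengap M X ≤ (M * relAbs N X).trace := by
  rw [relAbs, mul_smul_comm, trace_smul, smul_eq_mul, inv_mul_eq_div,
    le_div_iff₀ (eigengap_pos hN.det_pos hd)]
  refine le_of_sq_le_sq ?_
    (trace_mul_nonneg_of_posSemidef hM (posSemidef_sub_det_smul_adjugate hN hX hd.le))
  rw [mul_pow, eigengap_sq hM.det_nonneg hd.le, eigengap_sq hN.det_pos.le hd.le,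
    discrim_mul_discrim_eq (by simpa using hM.isHermitian) (by simpa using hN.isHermitian) hX]
  nlinarith [sq_nonneg ((M * X * N) 0 1 - (M * X * N) 1 0)]

theorem continuous_relAbs {T : Type*} [TopologicalSpace T] {f g : T → Matrix (Fin 2) (Fin 2) ℝ}
    (hf : Continuous f) (hg : Continuous g) (hfdet : ∀ t, 0 < (f t).det)
    (hgdet : ∀ t, (g t).det < 0) : Continuous fun t => relAbs (f t) (g t) := by
  unfold relAbs
  refine ((continuous_eigengap hf hg).inv₀ fun t => (eigengap_pos (hfdet t) (hgdet t)).ne').smul ?_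
  fun_prop

theorem neg_det_mul_trace_le_eigengap_mul_trace_relAbs (hN : N.PosDef) (hX : X.IsSymm)
    (hd : X.det < 0) : -X.det * N.trace ≤ eigengap N X * (relAbs N X).trace := by
  have hXNX : 0 ≤ (X * N * X).trace := by
    have h := (hN.posSemidef.conjTranspose_mul_mul_same X).trace_nonneg
    rwa [conjTranspose_eq_transpose_of_trivial, hX] at h
  have hadj : N.adjugate.trace = N.trace := by
    rw [adjugate_fin_two, trace_fin_two_of, trace_fin_two, add_comm]
  rw [relAbs, trace_smul, smul_eq_mul, mul_inv_cancel_left₀ (eigengap_pos hN.det_pos hd).ne',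
    trace_sub, trace_smul, hadj, smul_eq_mul]
  linarith

end RelAbs
theorem isCompact_setOf_mem_cone_and_eq_one {E : Type*} [NormedAddCommGroup E] [NormedSpace ℝ E]
    [FiniteDimensional ℝ E] {C : Set E} (hC : IsClosed C)
    (hsmul : ∀ c : ℝ, 0 ≤ c → ∀ x ∈ C, c • x ∈ C) (φ : E →L[ℝ] ℝ)
    (hφ : ∀ x ∈ C, x ≠ 0 → 0 < φ x) : IsCompact {x ∈ C | φ x = 1} := by
  have := FiniteDimensional.proper_real E
  obtain ⟨δ, hδ, hle⟩ := ((isCompact_sphere (0 : E) 1).inter_left hC).exists_forall_le'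
    φ.continuous.continuousOn fun x hx => hφ x hx.1 (ne_zero_of_mem_unit_sphere ⟨x, hx.2⟩)
  refine (isCompact_closedBall (0 : E) δ⁻¹).of_isClosed_subset
    (hC.inter (isClosed_eq φ.continuous continuous_const)) fun x hx => ?_
  have hx₀ : x ≠ 0 := by
    rintro rfl
    simpa using hx.2
  have h := hle (‖x‖⁻¹ • x) ⟨hsmul _ (by positivity) x hx.1, by simp [norm_smul, hx₀]⟩
  rw [map_smul, hx.2, smul_eq_mul, mul_one] at h
  rw [mem_closedBall_zero_iff]
  exact (le_inv_comm₀ hδ (norm_pos_iff.2 hx₀)).1 h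

theorem trace_mul_setIntegral {T n : Type*} [Fintype n] [DecidableEq n] [MeasurableSpace T]
    {μ : Measure T} {K : Set T} {f : T → Matrix n n ℝ} (hf : IntegrableOn f K μ)
    (A : Matrix n n ℝ) :
    (A * ∫ t in K, f t ∂μ).trace = ∫ t in K, (A * f t).trace ∂μ :=
  ((traceLinearMap n ℝ ℝ ∘ₗ LinearMap.mulLeft ℝ A).toContinuousLinearMap.integral_comp_comm hf).symm

section Maximizer

variable {T : Type*} [MeasurableSpace T]

/-- The integrated trace norm `∫_K tr |√M X √M|`, the functional to be maximised over `M`. -/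
noncomputable def totalGap (μ : Measure T) (K : Set T) (X : T → Matrix (Fin 2) (Fin 2) ℝ)
    (M : Matrix (Fin 2) (Fin 2) ℝ) : ℝ :=
  ∫ t in K, eigengap M (X t) ∂μ

/-- The integral over `K` of the relative absolute values `|X|_Y`, where `N = Y²`. -/
noncomputable def totalRelAbs (μ : Measure T) (K : Set T) (X : T → Matrix (Fin 2) (Fin 2) ℝ)
    (N : Matrix (Fin 2) (Fin 2) ℝ) : Matrix (Fin 2) (Fin 2) ℝ :=
  ∫ t in K, relAbs N (X t) ∂μ

/-- `M` maximises `totalGap` among the positive semidefinite matrices with `tr (M ρ) = 1`. The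
maximality is stated in its homogeneous form. -/
structure IsGapMaximizer (μ : Measure T) (K : Set T) (X : T → Matrix (Fin 2) (Fin 2) ℝ)
    (ρ M : Matrix (Fin 2) (Fin 2) ℝ) : Prop where
  posSemidef : M.PosSemidef
  trace_mul_eq_one : (M * ρ).trace = 1
  totalGap_le : ∀ N : Matrix (Fin 2) (Fin 2) ℝ, N.PosSemidef →
    totalGap μ K X N ≤ totalGap μ K X M * (N * ρ).trace

variable {μ : Measure T} {K : Set T} {X : T → Matrix (Fin 2) (Fin 2) ℝ}
  {ρ M N : Matrix (Fin 2) (Fin 2) ℝ}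

theorem totalGap_smul {c : ℝ} (hc : 0 ≤ c) : totalGap μ K X (c • M) = c * totalGap μ K X M := by
  simp only [totalGap, eigengap_smul hc, integral_const_mul]

variable [TopologicalSpace T] [OpensMeasurableSpace T] [IsLocallyFiniteMeasure μ]

theorem continuous_totalGap (hK : IsCompact K) (hX : Continuous X) :
    Continuous (totalGap μ K X) :=
  continuous_parametric_integral_of_continuous
    (continuous_eigengap continuous_fst (hX.comp continuous_snd)) hK

theorem exists_isGapMaximizer (hK : IsCompact K) (hX : Continuous X) (hρ : ρ.PosDef) :
    ∃ M, IsGapMaximizer μ K X ρ M := by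
  have htrace {A : Matrix (Fin 2) (Fin 2) ℝ} (hA : A.PosSemidef) (hA₀ : A ≠ 0) :
      0 < (A * ρ).trace := trace_mul_pos_of_posDef hA hA₀ hρ
  have hnorm {A : Matrix (Fin 2) (Fin 2) ℝ} (hA : A.PosSemidef) (hA₀ : A ≠ 0) :
      (A * ρ).trace⁻¹ • A ∈ {A | A.PosSemidef ∧ (A * ρ).trace = 1} :=
    ⟨hA.smul (inv_nonneg.2 (htrace hA hA₀).le), by
      rw [smul_mul_assoc, trace_smul, smul_eq_mul, inv_mul_cancel₀ (htrace hA hA₀).ne']⟩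
  have hcompact : IsCompact {A : Matrix (Fin 2) (Fin 2) ℝ | A.PosSemidef ∧ (A * ρ).trace = 1} :=
    isCompact_setOf_mem_cone_and_eq_one isClosed_setOf_posSemidef
      (fun c hc A (hA : A.PosSemidef) => hA.smul hc)
      (traceLinearMap (Fin 2) ℝ ℝ ∘ₗ LinearMap.mulRight ℝ ρ).toContinuousLinearMap
      fun A hA hA₀ => htrace hA hA₀
  obtain ⟨M, hM, hmax⟩ := hcompact.exists_isMaxOn ⟨_, hnorm PosSemidef.one one_ne_zero⟩
    (continuous_totalGap (μ := μ) hK hX).continuousOn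
  refine ⟨M, hM.1, hM.2, fun N hN => ?_⟩
  rcases eq_or_ne N 0 with rfl | hN₀
  · simpa using (totalGap_smul (M := 0) le_rfl).le
  · have h := hmax (hnorm hN hN₀)
    rw [Set.mem_ofPred_eq, totalGap_smul (inv_nonneg.2 (htrace hN hN₀).le)] at h
    exact (inv_mul_le_iff₀' (htrace hN hN₀)).1 h

theorem continuousAt_totalRelAbs (hK : IsCompact K) (hX : Continuous X)
    (hdet : ∀ t, (X t).det < 0) (hN : 0 < N.det) : ContinuousAt (totalRelAbs μ K X) N := by
  have hopen : IsOpen {N : Matrix (Fin 2) (Fin 2) ℝ | 0 < N.det} :=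
    isOpen_lt continuous_const continuous_id.matrix_det
  have := hopen.locallyCompactSpace
  refine ContinuousOn.continuousAt ?_ (hopen.mem_nhds hN)
  rw [continuousOn_iff_continuous_domRestrict]
  refine continuous_parametric_integral_of_continuous ?_ hK
  exact continuous_relAbs (continuous_subtype_val.comp continuous_fst) (hX.comp continuous_snd)
    (fun p => p.1.2) fun p => hdet p.2

variable [T2Space T]

theorem integrableOn_relAbs (hK : IsCompact K) (hX : Continuous X) (hdet : ∀ t, (X t).det < 0)
    (hN : 0 < N.det) : IntegrableOn (fun t => relAbs N (X t)) K μ :=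
  (continuous_relAbs continuous_const hX (fun _ => hN) hdet).continuousOn.integrableOn_compact hK

theorem trace_mul_totalRelAbs_self (hK : IsCompact K) (hX : Continuous X)
    (hdet : ∀ t, (X t).det < 0) (hN : 0 < N.det) :
    (N * totalRelAbs μ K X N).trace = totalGap μ K X N := by
  simp only [totalRelAbs, trace_mul_setIntegral (integrableOn_relAbs hK hX hdet hN),
    trace_mul_relAbs_self hN (hdet _), totalGap]

theorem totalGap_le_trace_mul_totalRelAbs (hK : IsCompact K) (hX : Continuous X)
    (hsymm : ∀ t, (X t).IsSymm) (hdet : ∀ t, (X t).det < 0) (hM : M.PosSemidef) (hN : N.PosDef) :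
    totalGap μ K X M ≤ (M * totalRelAbs μ K X N).trace := by
  have hcont := continuous_relAbs continuous_const hX (fun _ => hN.det_pos) hdet
  rw [totalRelAbs, trace_mul_setIntegral (integrableOn_relAbs hK hX hdet hN.det_pos)]
  exact setIntegral_mono
    ((continuous_eigengap continuous_const hX).continuousOn.integrableOn_compact hK)
    ((continuous_const.matrix_mul hcont).matrix_trace.continuousOn.integrableOn_compact hK)
    fun t => eigengap_le_trace_mul_relAbs hM hN (hsymm t) (hdet t)

theorem IsGapMaximizer.trace_mul_totalRelAbs_le (h : IsGapMaximizer μ K X ρ M) (hK : IsCompact K)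
    (hX : Continuous X) (hsymm : ∀ t, (X t).IsSymm) (hdet : ∀ t, (X t).det < 0)
    {V : Matrix (Fin 2) (Fin 2) ℝ} {ε : ℝ} (hε : 0 < ε) (hV : (M + ε • V).PosDef) :
    (V * totalRelAbs μ K X (M + ε • V)).trace ≤ totalGap μ K X M * (V * ρ).trace := by
  have hself := trace_mul_totalRelAbs_self (μ := μ) hK hX hdet hV.det_pos
  have hM := totalGap_le_trace_mul_totalRelAbs (μ := μ) hK hX hsymm hdet h.posSemidef hV
  have hmax := h.totalGap_le _ hV.posSemidef
  rw [← hself] at hmax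
  simp only [add_mul, trace_add, smul_mul_assoc, trace_smul, smul_eq_mul, h.trace_mul_eq_one]
    at hmax
  refine le_of_mul_le_mul_left ?_ hε
  linarith

theorem isSymm_totalRelAbs (hK : IsCompact K) (hX : Continuous X) (hsymm : ∀ t, (X t).IsSymm)
    (hdet : ∀ t, (X t).det < 0) (hN : N.PosDef) : (totalRelAbs μ K X N).IsSymm := by
  have hint := integrableOn_relAbs (μ := μ) hK hX hdet hN.det_pos
  have h := (transposeLinearEquiv (Fin 2) (Fin 2) ℝ ℝ).toLinearMap.toContinuousLinearMap
    |>.integral_comp_comm hint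
  refine h.symm.trans (integral_congr_ae (.of_forall fun t => ?_))
  exact (isHermitian_iff_isSymm.1 (posSemidef_relAbs hN (hsymm t) (hdet t).le).isHermitian).eq

theorem IsGapMaximizer.totalRelAbs_eq_smul (h : IsGapMaximizer μ K X ρ M) (hK : IsCompact K)
    (hX : Continuous X) (hsymm : ∀ t, (X t).IsSymm) (hdet : ∀ t, (X t).det < 0) (hM : M.PosDef)
    (hρ : ρ.IsSymm) : totalRelAbs μ K X M = totalGap μ K X M • ρ := by
  set V := totalRelAbs μ K X M - totalGap μ K X M • ρ with hVdef
  have hV : V.IsSymm := (isSymm_totalRelAbs hK hX hsymm hdet hM).sub (hρ.smul _)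
  have hlim : Tendsto (fun ε : ℝ => (V * totalRelAbs μ K X (M + ε • V)).trace) (𝓝[>] 0)
      (𝓝 (V * totalRelAbs μ K X M).trace) := by
    have hline : ContinuousAt (fun ε : ℝ => M + ε • V) 0 := by fun_prop
    have hG : ContinuousAt (totalRelAbs μ K X) (M + (0 : ℝ) • V) :=
      continuousAt_totalRelAbs hK hX hdet (by simpa using hM.det_pos)
    have htrace : Continuous fun A : Matrix (Fin 2) (Fin 2) ℝ => (V * A).trace := by fun_prop
    have hcomp : ContinuousAt (fun ε : ℝ => totalRelAbs μ K X (M + ε • V)) 0 :=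
      ContinuousAt.comp (f := fun ε : ℝ => M + ε • V) hG hline
    simpa [Function.comp_def] using
      (htrace.continuousAt.comp hcomp).tendsto.mono_left nhdsWithin_le_nhds
  have hle : (V * V).trace ≤ 0 := by
    have : (V * totalRelAbs μ K X M).trace ≤ totalGap μ K X M * (V * ρ).trace := by
      refine le_of_tendsto hlim ?_
      filter_upwards [(eventually_posDef_add_smul hM hV).filter_mono nhdsWithin_le_nhds,
        self_mem_nhdsWithin] with ε hε hε₀
      exact h.trace_mul_totalRelAbs_le hK hX hsymm hdet hε₀ hε
    nth_rw 2 [hVdef]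
    rw [mul_sub, trace_sub, mul_smul_comm, trace_smul, smul_eq_mul]
    linarith
  refine sub_eq_zero.1 (trace_conjTranspose_mul_self_eq_zero_iff.1 (le_antisymm ?_ ?_))
  · rwa [conjTranspose_eq_transpose_of_trivial, hV]
  · exact (posSemidef_conjTranspose_mul_self V).trace_nonneg

theorem lintegral_inv_eigengap_le (hK : IsCompact K) (hX : Continuous X)
    (hsymm : ∀ t, (X t).IsSymm) (hdet : ∀ t, (X t).det < 0) {δ : ℝ} (hδ : 0 < δ)
    (hδX : ∀ t ∈ K, δ ≤ -(X t).det) (hN : N.PosDef) :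
    ∫⁻ t in K, ‖eigengap N (X t)‖ₑ⁻¹ ∂μ ≤
      ENNReal.ofReal ((totalRelAbs μ K X N).trace / (δ * N.trace)) := by
  have hκ : 0 < δ * N.trace := mul_pos hδ hN.trace_pos
  have hint := integrableOn_relAbs (μ := μ) hK hX hdet hN.det_pos
  have htrace : IntegrableOn (fun t => (relAbs N (X t)).trace) K μ :=
    (traceLinearMap (Fin 2) ℝ ℝ).toContinuousLinearMap.integrable_comp hint
  have hnonneg t : 0 ≤ (relAbs N (X t)).trace / (δ * N.trace) :=
    div_nonneg (posSemidef_relAbs hN (hsymm t) (hdet t).le).trace_nonneg hκ.le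
  calc ∫⁻ t in K, ‖eigengap N (X t)‖ₑ⁻¹ ∂μ
      ≤ ∫⁻ t in K, ENNReal.ofReal ((relAbs N (X t)).trace / (δ * N.trace)) ∂μ := by
        refine setLIntegral_mono' hK.measurableSet fun t ht => ?_
        have hgap := eigengap_pos hN.det_pos (hdet t)
        rw [Real.enorm_of_nonneg hgap.le, ← ENNReal.ofReal_inv_of_pos hgap]
        refine ENNReal.ofReal_le_ofReal ?_
        rw [le_div_iff₀ hκ, inv_mul_le_iff₀ hgap]
        exact (mul_le_mul_of_nonneg_right (hδX t ht) hN.trace_pos.le).trans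
          (neg_det_mul_trace_le_eigengap_mul_trace_relAbs hN (hsymm t) (hdet t))
    _ = ENNReal.ofReal (∫ t in K, (relAbs N (X t)).trace / (δ * N.trace) ∂μ) :=
        (ofReal_integral_eq_lintegral_ofReal (htrace.div_const _) (.of_forall hnonneg)).symm
    _ = ENNReal.ofReal ((totalRelAbs μ K X N).trace / (δ * N.trace)) := by
        have h := trace_mul_setIntegral hint 1
        simp only [one_mul] at h
        rw [integral_div, totalRelAbs, h]

theorem IsGapMaximizer.lintegral_inv_eigengap_add_smul_one_le (h : IsGapMaximizer μ K X ρ M)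
    (hK : IsCompact K) (hX : Continuous X) (hsymm : ∀ t, (X t).IsSymm)
    (hdet : ∀ t, (X t).det < 0) {δ : ℝ} (hδ : 0 < δ) (hδX : ∀ t ∈ K, δ ≤ -(X t).det)
    {ε : ℝ} (hε : 0 < ε) :
    ∫⁻ t in K, ‖eigengap (M + ε • 1) (X t)‖ₑ⁻¹ ∂μ ≤
      ENNReal.ofReal (totalGap μ K X M * ρ.trace / (δ * M.trace)) := by
  have hN : (M + ε • 1).PosDef := PosDef.posSemidef_add h.posSemidef (PosDef.one.smul hε)
  have hM₀ : M ≠ 0 := by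
    rintro rfl
    simpa using h.trace_mul_eq_one
  have hM : 0 < M.trace :=
    h.posSemidef.trace_nonneg.lt_of_ne' (h.posSemidef.trace_eq_zero_iff.not.2 hM₀)
  have hle : M.trace ≤ (M + ε • 1).trace := by
    rw [trace_add, trace_smul, trace_one]
    simpa using hε.le
  have hnonneg : 0 ≤ totalGap μ K X M * ρ.trace := by
    have h₁ := h.totalGap_le 1 PosSemidef.one
    rw [one_mul] at h₁
    exact (integral_nonneg fun _ => eigengap_nonneg).trans h₁
  have hG : (totalRelAbs μ K X (M + ε • 1)).trace ≤ totalGap μ K X M * ρ.trace := by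
    simpa only [one_mul] using h.trace_mul_totalRelAbs_le hK hX hsymm hdet hε hN
  exact (lintegral_inv_eigengap_le hK hX hsymm hdet hδ hδX hN).trans
    (ENNReal.ofReal_le_ofReal (by gcongr))

-- `tr (totalRelAbs N)` is the derivative of `totalGap` at `N` in the direction of `1`; it dominates
-- the integral of `1 / eigengap N` and stays bounded as `N` tends to the maximiser `M`.
theorem IsGapMaximizer.lintegral_inv_eigengap_ne_top (h : IsGapMaximizer μ K X ρ M)
    (hK : IsCompact K) (hX : Continuous X) (hsymm : ∀ t, (X t).IsSymm)
    (hdet : ∀ t, (X t).det < 0) : ∫⁻ t in K, ‖eigengap M (X t)‖ₑ⁻¹ ∂μ ≠ ∞ := by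
  obtain ⟨δ, hδ, hδX⟩ := hK.exists_forall_le' (f := fun t => -(X t).det)
    hX.matrix_det.neg.continuousOn fun t _ => neg_pos.2 (hdet t)
  have hlim : ∀ t, Tendsto (fun ε : ℝ => ‖eigengap (M + ε • 1) (X t)‖ₑ⁻¹) (𝓝[>] 0)
      (𝓝 ‖eigengap M (X t)‖ₑ⁻¹) := by
    intro t
    have hcont : Continuous fun ε : ℝ => ‖eigengap (M + ε • 1) (X t)‖ₑ⁻¹ :=
      (continuous_eigengap (by fun_prop) continuous_const).enorm.inv
    simpa using (hcont.tendsto 0).mono_left nhdsWithin_le_nhds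
  refine ne_top_of_le_ne_top ENNReal.ofReal_ne_top
    (b := .ofReal (totalGap μ K X M * ρ.trace / (δ * M.trace))) ?_
  calc ∫⁻ t in K, ‖eigengap M (X t)‖ₑ⁻¹ ∂μ
      = ∫⁻ t in K, liminf (fun ε : ℝ => ‖eigengap (M + ε • 1) (X t)‖ₑ⁻¹) (𝓝[>] 0) ∂μ := by
        simp only [(hlim _).liminf_eq]
    _ ≤ liminf (fun ε : ℝ => ∫⁻ t in K, ‖eigengap (M + ε • 1) (X t)‖ₑ⁻¹ ∂μ) (𝓝[>] 0) :=
        lintegral_liminf_le fun ε => (continuous_eigengap continuous_const hX).enorm.inv.measurable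
    _ ≤ _ := by
        refine liminf_le_of_frequently_le' (Eventually.frequently ?_)
        filter_upwards [self_mem_nhdsWithin] with ε hε
        exact h.lintegral_inv_eigengap_add_smul_one_le hK hX hsymm hdet hδ hδX hε

end Maximizer

theorem lintegral_enorm_inv_eq_top_of_locallyLipschitzOn {E : Type*} [NormedAddCommGroup E]
    {f : ℝ → E} {a b c : ℝ} (hab : a < b) (hc : c ∈ Set.Icc a b)
    (hf : LocallyLipschitzOn (Set.Icc a b) f) (hfc : f c = 0) :
    ∫⁻ x in Set.Icc a b, ‖f x‖ₑ⁻¹ = ∞ := by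
  obtain ⟨K, hK⟩ := hf.exists_lipschitzOnWith_of_compact isCompact_Icc
  replace hK := hK.weaken (le_self_add : K ≤ K + 1)
  have htop : ∫⁻ x in Set.Icc a b, ‖(x - c)⁻¹‖ₑ = ∞ := by
    by_contra h
    have hint : IntervalIntegrable (fun x => (x - c)⁻¹) volume a b := by
      rw [intervalIntegrable_iff_integrableOn_Icc_of_le hab.le]
      exact ⟨by fun_prop, Ne.lt_top h⟩
    simp [intervalIntegrable_sub_inv_iff, hab.ne, Set.uIcc_of_le hab.le, hc.1, hc.2] at hint
  have hle : ∀ x ∈ Set.Icc a b, ‖(x - c)⁻¹‖ₑ ≤ ((K + 1 : NNReal) : ℝ≥0∞) * ‖f x‖ₑ⁻¹ := by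
    intro x hx
    rcases eq_or_ne x c with rfl | hxc
    · simp
    have h := hK hx hc
    rw [edist_eq_enorm_sub, edist_eq_enorm_sub, hfc, sub_zero] at h
    rw [enorm_inv (sub_ne_zero.2 hxc), ← div_eq_mul_inv,
      ENNReal.le_div_iff_mul_le (.inr (by simp)) (by simp), mul_comm, ← div_eq_mul_inv]
    exact ENNReal.div_le_of_le_mul h
  have := setLIntegral_mono' (μ := volume) measurableSet_Icc hle
  rw [htop, lintegral_const_mul' _ _ (by simp), top_le_iff, ENNReal.mul_eq_top] at this
  simpa using this

theorem exists_posDef_totalRelAbs_eq_smul {X : ℝ → Matrix (Fin 2) (Fin 2) ℝ}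
    {ρ : Matrix (Fin 2) (Fin 2) ℝ} {a b : ℝ} (hab : a < b) (hX : LocallyLipschitz X)
    (hsymm : ∀ t, (X t).IsSymm) (hdet : ∀ t, (X t).det < 0)
    (hzero : ∀ M : Matrix (Fin 2) (Fin 2) ℝ, ∃ t ∈ Set.Icc a b, (M * X t).trace = 0)
    (hρ : ρ.PosDef) :
    ∃ N : Matrix (Fin 2) (Fin 2) ℝ, N.PosDef ∧
      ∃ c : ℝ, totalRelAbs volume (Set.Icc a b) X N = c • ρ := by
  obtain ⟨M, hM⟩ := exists_isGapMaximizer (μ := volume) (isCompact_Icc (a := a) (b := b))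
    hX.continuous hρ
  have hMdet : M.det ≠ 0 := by
    intro hM₀
    obtain ⟨t₀, ht₀, hMt₀⟩ := hzero M
    have hlip : LocallyLipschitz fun t => (M * X t).trace :=
      (traceLinearMap (Fin 2) ℝ ℝ ∘ₗ LinearMap.mulLeft ℝ M).toContinuousLinearMap.lipschitz
        |>.locallyLipschitz.comp hX
    refine hM.lintegral_inv_eigengap_ne_top isCompact_Icc hX.continuous hsymm hdet ?_
    simp only [eigengap_of_det_eq_zero hM₀, Real.enorm_abs]
    exact lintegral_enorm_inv_eq_top_of_locallyLipschitzOn hab ht₀ hlip.locallyLipschitzOn hMt₀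
  have hMpos : M.PosDef := hM.posSemidef.posDef_iff_det_ne_zero.2 hMdet
  exact ⟨M, hMpos, _, hM.totalRelAbs_eq_smul isCompact_Icc hX.continuous hsymm hdet hMpos
    (isHermitian_iff_isSymm.1 hρ.isHermitian)⟩

theorem isSymm_map_re {n : Type*} {B : Matrix n n ℂ} (hB : B.IsHermitian) :
    (B.map Complex.re).IsSymm := by
  ext i j
  simpa using congrArg Complex.re (hB.apply i j)

section Complexify

variable {n : Type*} [Fintype n] [DecidableEq n] {A : Matrix n n ℝ}

/-- The embedding of real matrices into complex ones, as a homomorphism of real algebras. -/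
noncomputable abbrev complexify : Matrix n n ℝ →ₐ[ℝ] Matrix n n ℂ :=
  Complex.ofRealAm.mapMatrix

theorem complexify_apply (A : Matrix n n ℝ) (i j : n) : complexify A i j = (A i j : ℂ) :=
  rfl

theorem conjTranspose_complexify (A : Matrix n n ℝ) : (complexify A)ᴴ = complexify Aᴴ := by
  ext i j
  simp [complexify_apply]

theorem det_complexify (A : Matrix n n ℝ) : (complexify A).det = A.det :=
  (Complex.ofRealAm.map_det A).symm

theorem trace_complexify (A : Matrix n n ℝ) : (complexify A).trace = A.trace := by
  simp [trace]

theorem isRealMatrix_complexify (A : Matrix n n ℝ) : IsRealMatrix (complexify A) :=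
  fun i j => Complex.ofReal_im (A i j)

theorem complexify_map_re {B : Matrix n n ℂ} (hB : IsRealMatrix B) :
    complexify (B.map Complex.re) = B := by
  ext i j
  exact Complex.ext rfl (hB i j).symm

theorem posSemidef_complexify (hA : A.PosSemidef) : (complexify A).PosSemidef := by
  obtain ⟨C, rfl⟩ := CStarAlgebra.nonneg_iff_eq_star_mul_self.1 hA.nonneg
  rw [star_eq_conjTranspose, map_mul, ← conjTranspose_complexify]
  exact posSemidef_conjTranspose_mul_self _

theorem posDef_complexify_iff : (complexify A).PosDef ↔ A.PosDef := by
  refine ⟨fun h => .of_dotProduct_mulVec_pos ?_ fun x hx => ?_, fun h => ?_⟩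
  · have := h.isHermitian
    ext i j
    simpa [complexify_apply] using this.apply i j
  · have hx' : (fun i => (x i : ℂ)) ≠ 0 := fun h₀ =>
      hx (funext fun i => Complex.ofReal_eq_zero.1 (congrFun h₀ i))
    have := h.dotProduct_mulVec_pos hx'
    rw [← Complex.zero_lt_real]
    simpa [dotProduct, mulVec, complexify_apply] using this
  · rw [(posSemidef_complexify h.posSemidef).posDef_iff_det_ne_zero, det_complexify]
    exact_mod_cast h.det_pos.ne'

end Complexify

theorem exists_posDef_trace_eq_one_mul_self_eq_smul {n : Type*} [Fintype n] [Nonempty n]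
    {N : Matrix n n ℝ} (hN : N.PosDef) :
    ∃ Y : Matrix n n ℝ, Y.PosDef ∧ Y.trace = 1 ∧ ∃ c : ℝ, 0 < c ∧ Y * Y = c • N := by
  classical
  set S := CFC.sqrt N
  have hSS : S * S = N := CFC.sqrt_mul_sqrt_self N hN.posSemidef.nonneg
  have hS : S.PosDef := (hN.isStrictlyPositive.sqrt N).posDef
  have htr := hS.trace_pos
  refine ⟨S.trace⁻¹ • S, hS.smul (inv_pos.2 htr), ?_, S.trace⁻¹ * S.trace⁻¹, by positivity, ?_⟩
  · rw [trace_smul, smul_eq_mul, inv_mul_cancel₀ htr.ne']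
  · rw [smul_mul_smul_comm, hSS]

theorem cfcAbs_complexify_mul_mul {X Y : Matrix (Fin 2) (Fin 2) ℝ} (hY : Y.PosDef)
    (hX : X.IsSymm) (hd : X.det < 0) :
    CFC.abs (complexify (Y * X * Y)) = complexify (Y * relAbs (Y * Y) X * Y) := by
  have hY' : Yᴴ = Y := hY.isHermitian
  have hYY : (Y * Y).PosDef := by
    nth_rw 1 [← hY']
    exact .conjTranspose_mul_self Y (mulVec_injective_of_isUnit hY.isUnit)
  have hself : (Y * X * Y)ᴴ = Y * X * Y := by
    rw [conjTranspose_mul, conjTranspose_mul, hY', conjTranspose_eq_transpose_of_trivial X, hX,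
      mul_assoc]
  refine CFC.sqrt_unique ?_ (posSemidef_complexify ?_).nonneg
  · rw [star_eq_conjTranspose, conjTranspose_complexify, hself, ← map_mul, ← map_mul]
    congr 1
    calc Y * relAbs (Y * Y) X * Y * (Y * relAbs (Y * Y) X * Y)
        = Y * (relAbs (Y * Y) X * (Y * Y) * relAbs (Y * Y) X) * Y := by simp only [mul_assoc]
      _ = Y * X * Y * (Y * X * Y) := by
        rw [relAbs_mul_mul_relAbs hYY.det_pos hd]
        simp only [mul_assoc]
  · nth_rw 1 [← hY']
    exact (posSemidef_relAbs hYY hX hd.le).conjTranspose_mul_mul_same Y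

theorem absRel_complexify {X Y : Matrix (Fin 2) (Fin 2) ℝ} (hY : Y.PosDef) (hX : X.IsSymm)
    (hd : X.det < 0) :
    absRel (complexify Y) (complexify X) = complexify (relAbs (Y * Y) X) := by
  have hYu : IsUnit (complexify Y).det := by
    rw [det_complexify]
    exact (Complex.ofReal_ne_zero.2 hY.det_pos.ne').isUnit
  rw [absRel, ← map_mul, ← map_mul, cfcAbs_complexify_mul_mul hY hX hd, map_mul, map_mul,
    mul_assoc, mul_nonsing_inv_cancel_right _ _ hYu, nonsing_inv_mul_cancel_left _ _ hYu]

theorem det_neg_of_trace_mul_eq_zero {R : Type*} [Field R] [LinearOrder R] [IsStrictOrderedRing R]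
    {H X : Matrix (Fin 2) (Fin 2) R} (hH : H.IsSymm) (hX : X.IsSymm)
    (hdet : 0 < H.det) (htr : (H * X).trace = 0) (hX₀ : X ≠ 0) : X.det < 0 := by
  have hH' := hH.apply 0 1
  have hX' := hX.apply 0 1
  have htr' : H 0 0 * X 0 0 = -(2 * H 0 1 * X 0 1 + H 1 1 * X 1 1) := by
    simp only [trace_fin_two, mul_apply, Fin.sum_univ_two, hH', hX'] at htr
    linarith
  have hdetH : H.det = H 0 0 * H 1 1 - H 0 1 ^ 2 := by rw [det_fin_two, hH', sq]
  have hH₀ : H 0 0 ≠ 0 := by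
    intro h
    rw [hdetH, h] at hdet
    nlinarith [sq_nonneg (H 0 1)]
  have hsq : H 0 0 ^ 2 * -X.det =
      (H 0 0 * X 0 1 + H 0 1 * X 1 1) ^ 2 + H.det * X 1 1 ^ 2 := by
    rw [hdetH, det_fin_two, hX']
    linear_combination -(H 0 0 * X 1 1) * htr'
  by_contra! hXdet
  have hle : H 0 0 ^ 2 * -X.det ≤ 0 :=
    mul_nonpos_of_nonneg_of_nonpos (sq_nonneg _) (neg_nonpos.2 hXdet)
  have h₁₁ : X 1 1 = 0 := by
    by_contra h
    have : 0 < H.det * X 1 1 ^ 2 := by positivity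
    nlinarith [sq_nonneg (H 0 0 * X 0 1 + H 0 1 * X 1 1)]
  have h₀₁ : X 0 1 = 0 := by
    rw [hsq, h₁₁] at hle
    have : (H 0 0 * X 0 1) ^ 2 ≤ 0 := by simpa using hle
    simpa [hH₀] using pow_eq_zero_iff two_ne_zero |>.1 (le_antisymm this (sq_nonneg _))
  have h₀₀ : X 0 0 = 0 := by simpa [h₁₁, h₀₁, hH₀] using htr'
  refine hX₀ ?_
  ext i j
  fin_cases i <;> fin_cases j <;> simp [h₀₀, h₀₁, h₁₁, hX']

section Steering

variable {ρ : Matrix (Fin 2 × Fin 2) (Fin 2 × Fin 2) ℂ} {A : Matrix (Fin 2) (Fin 2) ℂ}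

theorem partialTraceA_kronecker_one_mul_comm (A : Matrix (Fin 2) (Fin 2) ℂ)
    (M : Matrix (Fin 2 × Fin 2) (Fin 2 × Fin 2) ℂ) :
    partialTraceA ((A ⊗ₖ (1 : Matrix (Fin 2) (Fin 2) ℂ)) * M) =
      partialTraceA (M * (A ⊗ₖ (1 : Matrix (Fin 2) (Fin 2) ℂ))) := by
  ext i j
  simp only [partialTraceA, of_apply, mul_apply, Fintype.sum_prod_type, kronecker_apply, one_apply,
    mul_ite, mul_one, mul_zero, ite_mul, zero_mul, Finset.sum_ite_eq, Finset.sum_ite_eq',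
    Finset.mem_univ, if_true]
  rw [Finset.sum_comm]
  simp only [mul_comm]

theorem posSemidef_partialTraceA (hρ : ρ.PosSemidef) : (partialTraceA ρ).PosSemidef := by
  have h : partialTraceA ρ = ∑ k, ρ.submatrix (Prod.mk k) (Prod.mk k) := by
    ext i j
    simp [partialTraceA, Matrix.sum_apply]
  rw [h]
  exact posSemidef_sum _ fun k _ => hρ.submatrix _

/-- The map `A ↦ Tr_A ((A ⊗ 𝕀) ρ_AB)`, which sends the effect `A` measured on the first system to
the operator it steers the second system to. -/
noncomputable def steeringMap (ρ : Matrix (Fin 2 × Fin 2) (Fin 2 × Fin 2) ℂ) :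
    Matrix (Fin 2) (Fin 2) ℂ →ₗ[ℝ] Matrix (Fin 2) (Fin 2) ℂ where
  toFun A := partialTraceA ((A ⊗ₖ (1 : Matrix (Fin 2) (Fin 2) ℂ)) * ρ)
  map_add' A B := by
    ext i j
    simp [partialTraceA, add_kronecker, add_mul, Finset.sum_add_distrib]
  map_smul' c A := by
    ext i j
    simp [partialTraceA, smul_kronecker]

theorem steeringMap_one (ρ : Matrix (Fin 2 × Fin 2) (Fin 2 × Fin 2) ℂ) :
    steeringMap ρ 1 = reducedB ρ := by
  simp [steeringMap, reducedB]

theorem steeringMap_projTheta (ρ : Matrix (Fin 2 × Fin 2) (Fin 2 × Fin 2) ℂ) (θ : ℝ) :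
    steeringMap ρ (projTheta θ) = steeringEllipse ρ θ :=
  rfl

theorem posSemidef_steeringMap (hρ : ρ.PosSemidef) (hA : A.PosSemidef) :
    (steeringMap ρ A).PosSemidef := by
  obtain ⟨C, rfl⟩ := CStarAlgebra.nonneg_iff_eq_star_mul_self.1 hA.nonneg
  have h : (star C * C) ⊗ₖ (1 : Matrix (Fin 2) (Fin 2) ℂ) =
      (Cᴴ ⊗ₖ (1 : Matrix (Fin 2) (Fin 2) ℂ)) * (C ⊗ₖ (1 : Matrix (Fin 2) (Fin 2) ℂ)) := by
    rw [← mul_kronecker_mul, one_mul, star_eq_conjTranspose]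
  change (partialTraceA _).PosSemidef
  rw [h, mul_assoc, partialTraceA_kronecker_one_mul_comm]
  have := hρ.mul_mul_conjTranspose_same (C ⊗ₖ (1 : Matrix (Fin 2) (Fin 2) ℂ))
  rw [conjTranspose_kronecker, conjTranspose_one] at this
  exact posSemidef_partialTraceA this

theorem projTheta_eq (θ : ℝ) :
    projTheta θ = (1 / 2 : ℝ) • (1 + Real.cos θ • pauliThree + Real.sin θ • pauliOne) := by
  have hcos : Real.cos θ = 2 * Real.cos (θ / 2) ^ 2 - 1 := by
    rw [← Real.cos_two_mul, mul_div_cancel₀ θ two_ne_zero]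
  have hsin : Real.sin θ = 2 * Real.sin (θ / 2) * Real.cos (θ / 2) := by
    rw [← Real.sin_two_mul, mul_div_cancel₀ θ two_ne_zero]
  have hpyth := Complex.sin_sq_add_cos_sq (θ / 2)
  ext i j
  rw [projTheta_apply]
  fin_cases i <;> fin_cases j <;> simp [pauliOne, pauliThree, hcos, hsin] <;> grind

theorem projTheta_add_projTheta_add_pi (θ : ℝ) : projTheta θ + projTheta (θ + Real.pi) = 1 := by
  rw [projTheta_eq, projTheta_eq, Real.cos_add_pi, Real.sin_add_pi]
  module

theorem steeringEllipse_add_steeringEllipse_add_pi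
    (ρ : Matrix (Fin 2 × Fin 2) (Fin 2 × Fin 2) ℂ) (θ : ℝ) :
    steeringEllipse ρ θ + steeringEllipse ρ (θ + Real.pi) = reducedB ρ := by
  rw [← steeringMap_projTheta, ← steeringMap_projTheta, ← map_add, projTheta_add_projTheta_add_pi,
    steeringMap_one]

theorem steeringEllipse_eq (ρ : Matrix (Fin 2 × Fin 2) (Fin 2 × Fin 2) ℂ) (θ : ℝ) :
    steeringEllipse ρ θ = (1 / 2 : ℝ) • (reducedB ρ + Real.cos θ • steeringMap ρ pauliThree +
      Real.sin θ • steeringMap ρ pauliOne) := by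
  rw [← steeringMap_projTheta, projTheta_eq]
  simp only [map_smul, map_add, steeringMap_one]

theorem deriv_steeringEllipse (ρ : Matrix (Fin 2 × Fin 2) (Fin 2 × Fin 2) ℂ) (θ : ℝ) :
    deriv (steeringEllipse ρ) θ = (1 / 2 : ℝ) •
      (Real.cos θ • steeringMap ρ pauliOne - Real.sin θ • steeringMap ρ pauliThree) := by
  have h := ((((Real.hasDerivAt_cos θ).smul_const (steeringMap ρ pauliThree)).const_add
    (reducedB ρ)).add ((Real.hasDerivAt_sin θ).smul_const (steeringMap ρ pauliOne))).const_smul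
    (1 / 2 : ℝ)
  rw [funext (steeringEllipse_eq ρ)]
  refine h.deriv.trans ?_
  module

theorem deriv_steeringEllipse_eq_sub (ρ : Matrix (Fin 2 × Fin 2) (Fin 2 × Fin 2) ℂ) (θ : ℝ) :
    deriv (steeringEllipse ρ) θ = (1 / 2 : ℝ) •
      (steeringEllipse ρ (θ + Real.pi / 2) - steeringEllipse ρ (θ - Real.pi / 2)) := by
  simp only [deriv_steeringEllipse, steeringEllipse_eq, Real.cos_add_pi_div_two,
    Real.sin_add_pi_div_two, Real.cos_sub_pi_div_two, Real.sin_sub_pi_div_two]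
  module

theorem deriv_steeringEllipse_mem_steeringDirection
    (ρ : Matrix (Fin 2 × Fin 2) (Fin 2 × Fin 2) ℂ) (θ : ℝ) :
    deriv (steeringEllipse ρ) θ ∈ steeringDirection ρ := by
  rw [deriv_steeringEllipse_eq_sub]
  exact Submodule.smul_mem _ _ <| AffineSubspace.vsub_mem_direction
    (mem_affineSpan ℝ (Set.mem_range_self _)) (mem_affineSpan ℝ (Set.mem_range_self _))

theorem steeringDirection_le_span (ρ : Matrix (Fin 2 × Fin 2) (Fin 2 × Fin 2) ℂ) :
    steeringDirection ρ ≤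
      Submodule.span ℝ (Set.range ![steeringMap ρ pauliOne, steeringMap ρ pauliThree]) := by
  rw [steeringDirection, direction_affineSpan, vectorSpan_def, Submodule.span_le]
  rintro _ ⟨_, ⟨s, rfl⟩, _, ⟨t, rfl⟩, rfl⟩
  rw [range_cons_cons_empty, SetLike.mem_coe, Submodule.mem_span_pair]
  refine ⟨(Real.sin s - Real.sin t) / 2, (Real.cos s - Real.cos t) / 2, ?_⟩
  simp only [steeringEllipse_eq, vsub_eq_sub]
  module

theorem deriv_steeringEllipse_ne_zero (h : Module.finrank ℝ (steeringDirection ρ) = 2) (θ : ℝ) :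
    deriv (steeringEllipse ρ) θ ≠ 0 := by
  have hindep : LinearIndependent ℝ ![steeringMap ρ pauliOne, steeringMap ρ pauliThree] := by
    rw [linearIndependent_iff_card_le_finrank_span, Fintype.card_fin]
    exact h.ge.trans (Submodule.finrank_mono (steeringDirection_le_span ρ))
  rw [deriv_steeringEllipse, smul_sub, smul_smul, smul_smul, sub_eq_add_neg, ← neg_smul]
  intro h₀
  obtain ⟨hcos, hsin⟩ := LinearIndependent.pair_iff.1 hindep _ _ h₀
  nlinarith [Real.sin_sq_add_cos_sq θ]

theorem isHermitian_deriv_steeringEllipse (hρ : IsRealDensity ρ) (θ : ℝ) :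
    (deriv (steeringEllipse ρ) θ).IsHermitian := by
  rw [deriv_steeringEllipse_eq_sub]
  exact ((steeringEllipse_real hρ _).1.sub (steeringEllipse_real hρ _).1).smul (.all _)

theorem isRealMatrix_deriv_steeringEllipse (hρ : IsRealDensity ρ) (θ : ℝ) :
    IsRealMatrix (deriv (steeringEllipse ρ) θ) := by
  intro i j
  have h t : (steeringEllipse ρ t i j).im = 0 := (steeringEllipse_real hρ t).2 i j
  simp [deriv_steeringEllipse_eq_sub, h]

theorem isRealMatrix_reducedB (hρ : IsRealDensity ρ) : IsRealMatrix (reducedB ρ) := by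
  intro i j
  simp [← steeringEllipse_add_steeringEllipse_add_pi ρ 0, (steeringEllipse_real hρ _).2 i j]

theorem deriv_steeringEllipse_add_pi (ρ : Matrix (Fin 2 × Fin 2) (Fin 2 × Fin 2) ℂ) (θ : ℝ) :
    deriv (steeringEllipse ρ) (θ + Real.pi) = -deriv (steeringEllipse ρ) θ := by
  simp only [deriv_steeringEllipse, Real.cos_add_pi, Real.sin_add_pi]
  module

theorem mulVec_eq_zero_of_reducedB_mulVec_eq_zero (hρ : ρ.PosSemidef) {v : Fin 2 → ℂ}
    (hv : reducedB ρ *ᵥ v = 0) (θ : ℝ) : steeringEllipse ρ θ *ᵥ v = 0 := by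
  have hpsd t : (steeringEllipse ρ t).PosSemidef :=
    posSemidef_steeringMap hρ (posSemidef_vecMulVec_self_star _)
  rw [← (hpsd θ).dotProduct_mulVec_zero_iff]
  refine le_antisymm ?_ ((hpsd θ).dotProduct_mulVec_nonneg v)
  have hsum := congrArg (star v ⬝ᵥ ·) hv
  simp only [← steeringEllipse_add_steeringEllipse_add_pi ρ θ, add_mulVec, dotProduct_add,
    dotProduct_zero] at hsum
  rw [eq_neg_of_add_eq_zero_left hsum]
  exact neg_nonpos.2 ((hpsd _).dotProduct_mulVec_nonneg v)

/-- The derivative of the steering ellipse of a real state, as a real matrix. -/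
noncomputable def steeringVelocity (ρ : Matrix (Fin 2 × Fin 2) (Fin 2 × Fin 2) ℂ) (θ : ℝ) :
    Matrix (Fin 2) (Fin 2) ℝ :=
  (deriv (steeringEllipse ρ) θ).map Complex.re

theorem complexify_steeringVelocity (hρ : IsRealDensity ρ) (θ : ℝ) :
    complexify (steeringVelocity ρ θ) = deriv (steeringEllipse ρ) θ :=
  complexify_map_re (isRealMatrix_deriv_steeringEllipse hρ θ)

theorem isSymm_steeringVelocity (hρ : IsRealDensity ρ) (θ : ℝ) :
    (steeringVelocity ρ θ).IsSymm :=
  isSymm_map_re (isHermitian_deriv_steeringEllipse hρ θ)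

theorem steeringVelocity_add_pi (ρ : Matrix (Fin 2 × Fin 2) (Fin 2 × Fin 2) ℂ) (θ : ℝ) :
    steeringVelocity ρ (θ + Real.pi) = -steeringVelocity ρ θ := by
  ext i j
  simp [steeringVelocity, deriv_steeringEllipse_add_pi]

theorem contDiff_steeringVelocity (ρ : Matrix (Fin 2 × Fin 2) (Fin 2 × Fin 2) ℂ)
    (n : WithTop ℕ∞) : ContDiff ℝ n (steeringVelocity ρ) := by
  have h : steeringVelocity ρ = fun θ => (1 / 2 : ℝ) •
      (Real.cos θ • (steeringMap ρ pauliOne).map Complex.re -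
        Real.sin θ • (steeringMap ρ pauliThree).map Complex.re) := by
    ext θ i j
    simp [steeringVelocity, deriv_steeringEllipse, -Complex.ofReal_cos, -Complex.ofReal_sin]
  rw [h]
  fun_prop

theorem exists_trace_mul_steeringVelocity_eq_zero
    (ρ : Matrix (Fin 2 × Fin 2) (Fin 2 × Fin 2) ℂ) (M : Matrix (Fin 2) (Fin 2) ℝ) :
    ∃ θ ∈ Set.Icc 0 (2 * Real.pi), (M * steeringVelocity ρ θ).trace = 0 := by
  have hcont : Continuous fun θ => (M * steeringVelocity ρ θ).trace :=
    (continuous_const.matrix_mul (contDiff_steeringVelocity ρ 0).continuous).matrix_trace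
  have hpi : (M * steeringVelocity ρ Real.pi).trace = -(M * steeringVelocity ρ 0).trace := by
    rw [← zero_add Real.pi, steeringVelocity_add_pi, mul_neg, trace_neg]
  have hmem : (0 : ℝ) ∈ Set.uIcc (M * steeringVelocity ρ 0).trace
      (M * steeringVelocity ρ Real.pi).trace := by
    rw [hpi, Set.mem_uIcc]
    rcases le_total 0 (M * steeringVelocity ρ 0).trace with h | h
    · exact .inr ⟨neg_nonpos.2 h, h⟩
    · exact .inl ⟨h, neg_nonneg.2 h⟩
  obtain ⟨θ, hθ, hzero⟩ := intermediate_value_uIcc hcont.continuousOn hmem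
  rw [Set.uIcc_of_le Real.pi_pos.le] at hθ
  exact ⟨θ, ⟨hθ.1, hθ.2.trans (by linarith [Real.pi_pos])⟩, hzero⟩

theorem finrank_steeringDirection_eq_two (htilt : steeringTilt ρ < 1) :
    Module.finrank ℝ (steeringDirection ρ) = 2 := by
  by_contra h
  simp [steeringTilt, h] at htilt

theorem exists_isSteeringNormal_tilt_lt_one (htilt : steeringTilt ρ < 1) :
    ∃ H, IsSteeringNormal ρ H ∧ tilt H < 1 := by
  rw [steeringTilt, if_pos (finrank_steeringDirection_eq_two htilt)] at htilt
  simpa only [iInf_lt_iff, exists_prop] using htilt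

theorem det_map_re_pos_of_tilt_lt_one {H : Matrix (Fin 2) (Fin 2) ℂ} (hH : H.IsHermitian)
    (htilt : tilt H < 1) : 0 < (H.map Complex.re).det := by
  have hN : coordN H ≠ 0 := by
    intro h
    simp [tilt, h] at htilt
  rw [tilt, if_neg hN, ENNReal.ofReal_lt_one, div_lt_one (abs_pos.2 hN),
    Real.sqrt_lt' (abs_pos.2 hN), sq_abs, coordN_eq, coordOne_eq, coordThree_eq] at htilt
  have hsymm : (H 1 0).re = (H 0 1).re := (isSymm_map_re hH).apply 0 1
  rw [hsymm] at htilt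
  simp only [det_fin_two, map_apply, hsymm]
  linarith

theorem det_steeringVelocity_neg (hρ : IsRealDensity ρ) (htilt : steeringTilt ρ < 1) (θ : ℝ) :
    (steeringVelocity ρ θ).det < 0 := by
  obtain ⟨H, hH, htiltH⟩ := exists_isSteeringNormal_tilt_lt_one htilt
  refine det_neg_of_trace_mul_eq_zero (isSymm_map_re hH.isHermitian)
    (isSymm_steeringVelocity hρ θ) (det_map_re_pos_of_tilt_lt_one hH.isHermitian htiltH) ?_ ?_
  · have h := hH.normal _ (deriv_steeringEllipse_mem_steeringDirection ρ θ)
    rw [hH.isHermitian, ← complexify_map_re hH.real, ← complexify_steeringVelocity hρ, ← map_mul,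
      trace_complexify] at h
    exact_mod_cast h
  · intro h
    refine deriv_steeringEllipse_ne_zero (finrank_steeringDirection_eq_two htilt) θ ?_
    rw [← complexify_steeringVelocity hρ, h, map_zero]

theorem posDef_reducedB (hρ : IsRealDensity ρ) (htilt : steeringTilt ρ < 1) :
    (reducedB ρ).PosDef := by
  have hpsd : (reducedB ρ).PosSemidef := posSemidef_partialTraceA hρ.posSemidef
  rw [hpsd.posDef_iff_det_ne_zero]
  intro hdet
  obtain ⟨v, hv₀, hv⟩ := exists_mulVec_eq_zero_iff.2 hdet
  have hderiv : deriv (steeringEllipse ρ) 0 *ᵥ v = 0 := by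
    simp only [deriv_steeringEllipse_eq_sub, smul_mulVec, sub_mulVec,
      mulVec_eq_zero_of_reducedB_mulVec_eq_zero hρ.posSemidef hv, sub_zero, smul_zero]
  have hdet₀ := exists_mulVec_eq_zero_iff.1 ⟨v, hv₀, hderiv⟩
  rw [← complexify_steeringVelocity hρ, det_complexify, Complex.ofReal_eq_zero] at hdet₀
  exact (det_steeringVelocity_neg hρ htilt 0).ne hdet₀

theorem exists_posDef_totalRelAbs_steeringVelocity_eq_smul (hρ : IsRealDensity ρ)
    (htilt : steeringTilt ρ < 1) :
    ∃ N : Matrix (Fin 2) (Fin 2) ℝ, N.PosDef ∧ ∃ c : ℝ,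
      totalRelAbs volume (Set.Icc 0 (2 * Real.pi)) (steeringVelocity ρ) N =
        c • (reducedB ρ).map Complex.re := by
  refine exists_posDef_totalRelAbs_eq_smul Real.two_pi_pos
    (contDiff_steeringVelocity ρ 1).locallyLipschitz (isSymm_steeringVelocity hρ)
    (det_steeringVelocity_neg hρ htilt) (exists_trace_mul_steeringVelocity_eq_zero ρ) ?_
  rw [← posDef_complexify_iff, complexify_map_re (isRealMatrix_reducedB hρ)]
  exact posDef_reducedB hρ htilt

end Steering

theorem mainTheorem7 (ρ : Matrix (Fin 2 × Fin 2) (Fin 2 × Fin 2) ℂ) (hρ : IsRealDensity ρ)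
    (htilt : steeringTilt ρ < 1) :
    ∃ Y : Matrix (Fin 2) (Fin 2) ℂ, IsPosDefRealDensity Y ∧
      IntervalIntegrable (fun θ : ℝ => absRel Y (deriv (steeringEllipse ρ) θ))
        MeasureTheory.volume 0 (2 * Real.pi) ∧
      ∃ c : ℝ, ∫ θ in (0 : ℝ)..(2 * Real.pi), absRel Y (deriv (steeringEllipse ρ) θ) =
        c • reducedB ρ := by
  obtain ⟨N, hN, c, hc⟩ := exists_posDef_totalRelAbs_steeringVelocity_eq_smul hρ htilt
  obtain ⟨Y, hY, hYtrace, k, hk, hYY⟩ := exists_posDef_trace_eq_one_mul_self_eq_smul hN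
  have habs θ : absRel (complexify Y) (deriv (steeringEllipse ρ) θ) =
      complexify (relAbs N (steeringVelocity ρ θ)) := by
    rw [← complexify_steeringVelocity hρ, absRel_complexify hY (isSymm_steeringVelocity hρ θ)
      (det_steeringVelocity_neg hρ htilt θ), hYY, relAbs_smul hk]
  have hint : IntegrableOn (fun θ => relAbs N (steeringVelocity ρ θ))
      (Set.Icc 0 (2 * Real.pi)) :=
    integrableOn_relAbs isCompact_Icc (contDiff_steeringVelocity ρ 0).continuous
      (det_steeringVelocity_neg hρ htilt) hN.det_pos
  let L := (complexify (n := Fin 2)).toLinearMap.toContinuousLinearMap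
  refine ⟨complexify Y, ⟨isRealMatrix_complexify Y, posDef_complexify_iff.2 hY, by
    rw [trace_complexify, hYtrace, Complex.ofReal_one]⟩, ?_, c, ?_⟩
  · simp only [habs]
    exact (intervalIntegrable_iff_integrableOn_Icc_of_le Real.two_pi_pos.le).2
      (L.integrable_comp hint)
  · simp only [habs]
    rw [intervalIntegral.integral_of_le Real.two_pi_pos.le, ← integral_Icc_eq_integral_Ioc]
    refine (L.integral_comp_comm hint).trans ((congrArg L hc).trans ?_)
    rw [map_smul]
    exact congrArg _ (complexify_map_re (isRealMatrix_reducedB hρ))
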